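/- Let $F$ be a field of characteristic different from $2$. Let $D$ be a connected diagonalizable algebraic group over $F$ with character group $X$ (a finitely generated abelian group), so that $F[D]=FX$ is the group algebra. Identify $Lie(D)$ with the space of linear maps $y:FX\to F$ such that $y(g_1g_2)=y(g_1)+y(g_2)$ for $g_1,g_2\in X$, and let $x\in Lie(D)$. Let $D_{1,x}$ be the affine supergroup with coordinate superalgebra $F[D_{1,x}]=FX\oplus (FX)z$, where $z$ is odd and $z^2=0$, and with coproduct $$\Delta(h)=h\otimes h+x(h)\,hz\otimes hz\quad (h\in X),\qquad \Delta(z)=1\otimes z+z\otimes 1 .$$ For $h\in X$ let $L(h)=Fh\oplus Fhz\subseteq F[D_{1,x}]$ (a subcomodule), and let $V$ be a $D_{1,x}$-supermodule with $V^*\simeq L(h_1)\oplus\dots\oplus L(h_s)$, where $h_1,\dots,h_s\in X$. Thus $F[V]$ is the polynomial superalgebra freely generated by even elements $f_{j,0}$ and odd elements $f_{j,1}$ $(1\le j\le s)$, all of degree one, and its coaction $\tau:F[V]\to F[V]\otimes F[D_{1,x}]$ is the superalgebra homomorphism with $$\tau(f_{j,0})=f_{j,0}\otimes h_j+x(h_j)f_{j,1}\otimes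 h_jz,\qquad \tau(f_{j,1})=f_{j,0}\otimes h_jz+f_{j,1}\otimes h_j ,$$ where tensor products of superalgebras are multiplied by $(a\otimes b)(c\otimes d)=(-1)^{|b||c|}ac\otimes bd$. Let $F[V]^{D_{1,x}}=\{a:\tau(a)=a\otimes 1\}$, let $\tau|_D:F[V]\to F[V]\otimes FX$ be obtained from $\tau$ by setting $z=0$, and let $A=F[V]^D=\{a: \tau|_D(a)=a\otimes 1\}$. Let $\phi$ be the linear functional on $F[D_{1,x}]$ with $\phi(h)=0$, $\phi(hz)=1$ for $h\in X$, acting on $F[V]$ by $\phi a=(\mathrm{id}\otimes\phi)\tau(a)$. For $G\in\{D,D_{1,x}\}$ let $M_{G,V}=\min\{d>0: F[V]_d\cap F[V]^G\ne 0\}$, and $M_{G,V}=\infty$ if there is no such $d$. Then the following hold. 1. $\phi$ is an odd superderivation of $F[V]$, in the sense that it reverses parity and $\phi(ab)=a\,\phi(b)+(-1)^{|b|}\phi(a)\,b$ for all $a$ and all homogeneous $b$; it satisfies $\phi f_{j,0}=x(h_j)f_{j,1}$ and $\phi f_{j,1}=f_{j,0}$. It preserves degrees and maps $A$ to itself. 2.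 $F[V]^{D_{1,x}}=\{a\in A:\phi a=0\}$. 3. There is a basis $\{v_i\}_{i\in I_1\sqcup I_2}$ of $A$, consisting of elements homogeneous with respect to the degree, such that $\{v_i\}_{i\in I_1}$ is a basis of $\phi A$. For every such basis there is exactly one row-finite matrix $C=(c_{ij})_{i\in I_2,\,j\in I_1}$ over $F$ with $\phi v_i=\sum_{j\in I_1}c_{ij}v_j$ for all $i\in I_2$, and the space $F[V]^{D_{1,x}}$ is spanned by the vectors $v_i$, $i\in I_1$, together with the vectors $\sum_{j\in I_2}d_jv_j$, where $d=(d_j)_{j\in I_2}$ runs over the finitely supported vectors over $F$ with $dC=0$. 4. $M_{D,V}=M_{D_{1,x},V}$. -/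

import Mathlib

open scoped TensorProduct DirectSum

universe u v w

/-! ### Polynomial superalgebras -/

/-- The defining relations `ab = (-1)^{|a||b|} ba` between generators `a, b` with parities given
by `p`. -/
inductive SuperPoly.Rel (F : Type u) [Field F] {κ : Type v} (p : κ → ZMod 2) :
    FreeAlgebra F κ → FreeAlgebra F κ → Prop
  | comm (k l : κ) : SuperPoly.Rel F p (FreeAlgebra.ι F k * FreeAlgebra.ι F l)
      ((-1 : ℤˣ) ^ (p k * p l) • (FreeAlgebra.ι F l * FreeAlgebra.ι F k))

/-- The supercommutative polynomial superalgebra over a field `F` (of characteristic different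
from `2`), freely generated by homogeneous generators indexed by `κ`, the generator `k` having
parity `p k`. -/
def SuperPoly (F : Type u) [Field F] {κ : Type v} (p : κ → ZMod 2) : Type max u v :=
  RingQuot (SuperPoly.Rel F p)

namespace SuperPoly

noncomputable instance instRing (F : Type u) [Field F] {κ : Type v} (p : κ → ZMod 2) :
    Ring (SuperPoly F p) :=
  inferInstanceAs (Ring (RingQuot (SuperPoly.Rel F p)))

noncomputable instance instAlgebra (F : Type u) [Field F] {κ : Type v} (p : κ → ZMod 2) :
    Algebra F (SuperPoly F p) :=
  inferInstanceAs (Algebra F (RingQuot (SuperPoly.Rel F p)))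

/-- The free generators. -/
noncomputable def gen (F : Type u) [Field F] {κ : Type v} (p : κ → ZMod 2) (k : κ) :
    SuperPoly F p :=
  RingQuot.mkAlgHom F (SuperPoly.Rel F p) (FreeAlgebra.ι F k)

theorem gen_mul_gen (F : Type u) [Field F] {κ : Type v} (p : κ → ZMod 2) (k l : κ) :
    gen F p k * gen F p l = (-1 : ℤˣ) ^ (p k * p l) • (gen F p l * gen F p k) := by
  have h := RingQuot.mkAlgHom_rel F (SuperPoly.Rel.comm (F := F) (p := p) k l)
  rw [map_mul, Units.smul_def, map_zsmul, map_mul] at h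
  rw [Units.smul_def]
  exact h

/-- The universal property. -/
noncomputable def lift {F : Type u} [Field F] {κ : Type v} (p : κ → ZMod 2) {T : Type w} [Ring T]
    [Algebra F T] (f : κ → T)
    (hf : ∀ k l, f k * f l = (-1 : ℤˣ) ^ (p k * p l) • (f l * f k)) : SuperPoly F p →ₐ[F] T :=
  RingQuot.liftAlgHom F ⟨FreeAlgebra.lift F f, by
    rintro _ _ ⟨k, l⟩
    rw [map_mul, Units.smul_def, map_zsmul, map_mul, FreeAlgebra.lift_ι_apply,
      FreeAlgebra.lift_ι_apply, ← Units.smul_def]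
    exact hf k l⟩

@[simp]
theorem lift_gen {F : Type u} [Field F] {κ : Type v} (p : κ → ZMod 2) {T : Type w} [Ring T]
    [Algebra F T] (f : κ → T)
    (hf : ∀ k l, f k * f l = (-1 : ℤˣ) ^ (p k * p l) • (f l * f k)) (k : κ) :
    lift p f hf (gen F p k) = f k := by
  have := RingQuot.liftAlgHom_mkAlgHom_apply (S := F) (FreeAlgebra.lift F f)
    (s := SuperPoly.Rel F p) (by
      rintro _ _ ⟨k, l⟩
      rw [map_mul, Units.smul_def, map_zsmul, map_mul, FreeAlgebra.lift_ι_apply,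
        FreeAlgebra.lift_ι_apply, ← Units.smul_def]
      exact hf k l) (FreeAlgebra.ι F k)
  rw [FreeAlgebra.lift_ι_apply] at this
  exact this

theorem algHom_ext {F : Type u} [Field F] {κ : Type v} {p : κ → ZMod 2} {T : Type w} [Ring T]
    [Algebra F T] {f g : SuperPoly F p →ₐ[F] T} (h : ∀ k, f (gen F p k) = g (gen F p k)) :
    f = g := by
  refine RingQuot.ringQuot_ext' F (s := SuperPoly.Rel F p) f g ?_
  refine FreeAlgebra.hom_ext ?_
  funext k
  exact h k

/-- The homogeneous component of weight `m`, where the generator `k` is given weight `W k`: the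
span of all products of generators of total weight `m`. With `W = p` this is the parity grading,
with `W = 1` it is the degree. -/
noncomputable def homog (F : Type u) [Field F] {κ : Type v} (p : κ → ZMod 2) {M : Type w} [AddCommMonoid M]
    (W : κ → M) (m : M) : Submodule F (SuperPoly F p) :=
  Submodule.span F {a | ∃ l : List κ, (l.map W).sum = m ∧ a = (l.map (gen F p)).prod}

theorem gen_mem_homog (F : Type u) [Field F] {κ : Type v} (p : κ → ZMod 2) {M : Type w}
    [AddCommMonoid M] (W : κ → M) (k : κ) : gen F p k ∈ homog F p W (W k) :=
  Submodule.subset_span ⟨[k], by simp, by simp⟩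

noncomputable instance gradedMonoid_homog (F : Type u) [Field F] {κ : Type v} (p : κ → ZMod 2) {M : Type w}
    [AddCommMonoid M] (W : κ → M) : SetLike.GradedMonoid (homog F p W) where
  one_mem := Submodule.subset_span ⟨[], by simp, by simp⟩
  mul_mem i j a b ha hb := by
    have h : homog F p W i * homog F p W j ≤ homog F p W (i + j) := by
      unfold homog
      rw [Submodule.span_mul_span]
      apply Submodule.span_mono
      rintro _ ⟨_, ⟨l, hl, rfl⟩, _, ⟨l', hl', rfl⟩, rfl⟩
      exact ⟨l ++ l', by simp [hl, hl'], by simp⟩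
    exact h (Submodule.mul_mem_mul ha hb)

/-- Splitting into homogeneous components, on the generators. -/
noncomputable def decomposeHom (F : Type u) [Field F] {κ : Type v} (p : κ → ZMod 2) {M : Type w}
    [AddCommMonoid M] [DecidableEq M] (W : κ → M) :
    SuperPoly F p →ₐ[F] ⨁ m, homog F p W m :=
  lift p (fun k => DirectSum.of (fun m => homog F p W m) (W k) ⟨gen F p k, gen_mem_homog F p W k⟩)
    (by
      intro k l
      have h := gen_mul_gen F p k l
      rw [DirectSum.of_mul_of, DirectSum.of_mul_of]
      rcases Int.units_eq_one_or ((-1 : ℤˣ) ^ (p k * p l)) with e | e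
      · rw [e, one_smul] at h ⊢
        exact DirectSum.of_eq_of_gradedMonoid_eq (Sigma.subtype_ext (add_comm _ _) h)
      · rw [e, Units.neg_smul, one_smul] at h
        rw [e]
        refine Eq.trans ?_ (neg_one_zsmul _).symm
        refine Eq.trans ?_ (map_neg (DirectSum.of (fun m => homog F p W m) (W l + W k)) _)
        exact DirectSum.of_eq_of_gradedMonoid_eq (Sigma.subtype_ext (add_comm _ _) h))

noncomputable instance gradedAlgebra_homog (F : Type u) [Field F] {κ : Type v} (p : κ → ZMod 2) {M : Type w}
    [AddCommMonoid M] [DecidableEq M] (W : κ → M) : GradedAlgebra (homog F p W) :=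
  GradedAlgebra.ofAlgHom _ (decomposeHom F p W)
    (by
      refine algHom_ext fun k => ?_
      simp [decomposeHom])
    (by
      rintro m ⟨a, ha⟩
      have key : ∀ l : List κ, decomposeHom F p W (l.map (gen F p)).prod =
          DirectSum.of (fun m => homog F p W m) (l.map W).sum
            ⟨(l.map (gen F p)).prod, Submodule.subset_span ⟨l, rfl, rfl⟩⟩ := by
        intro l
        induction l with
        | nil =>
          have h1 : decomposeHom F p W ([].map (gen F p)).prod = 1 := by simp
          rw [h1]
          rfl
        | cons k l ih =>
          have h1 : decomposeHom F p W ((k :: l).map (gen F p)).prod =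
              decomposeHom F p W (gen F p k) * decomposeHom F p W (l.map (gen F p)).prod := by
            rw [List.map_cons, List.prod_cons, map_mul]
          rw [h1, ih]
          have : decomposeHom F p W (gen F p k) = DirectSum.of (fun m => homog F p W m) (W k)
            ⟨gen F p k, gen_mem_homog F p W k⟩ := lift_gen _ _ _ _
          rw [this, DirectSum.of_mul_of]
          exact DirectSum.of_eq_of_gradedMonoid_eq (Sigma.subtype_ext rfl rfl)
      change decomposeHom F p W a = DirectSum.of (fun m => homog F p W m) m ⟨a, ha⟩
      induction ha using Submodule.span_induction with
      | mem x hx =>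
        obtain ⟨l, rfl, rfl⟩ := hx
        exact key l
      | zero =>
        rw [map_zero]
        exact (map_zero (DirectSum.of (fun m => homog F p W m) m)).symm
      | add x y hx hy ihx ihy => rw [map_add, ihx, ihy, ← map_add]; rfl
      | smul c x hx ih =>
        rw [map_smul, ih]
        exact ((DirectSum.lof F M (fun m => homog F p W m) m).map_smul c ⟨x, hx⟩).symm)

end SuperPoly

/-! ### The supergroup `D_{1,x}` -/

/-- `Lie(D)`, for the diagonalizable group `D` with character group `X` and coordinate algebra the
group algebra `FX`: the linear maps `y : FX → F` with `y(g₁g₂) = y(g₁) + y(g₂)` for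
`g₁, g₂ ∈ X`. -/
def LieD (F : Type u) [Field F] (X : Type v) [CommGroup X] :
    Submodule F (Module.Dual F (MonoidAlgebra F X)) where
  carrier := {y | ∀ g₁ g₂ : X, y (MonoidAlgebra.of F X (g₁ * g₂)) =
    y (MonoidAlgebra.of F X g₁) + y (MonoidAlgebra.of F X g₂)}
  add_mem' {y z} hy hz g₁ g₂ := by
    rw [LinearMap.add_apply, LinearMap.add_apply, LinearMap.add_apply, hy, hz]
    ring
  zero_mem' g₁ g₂ := by simp
  smul_mem' c y hy g₁ g₂ := by
    rw [LinearMap.smul_apply, LinearMap.smul_apply, LinearMap.smul_apply, hy, smul_add]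

/-- The value `x(h)` of `x ∈ Lie(D)` at a character `h ∈ X`. -/
noncomputable def LieD.eval {F : Type u} [Field F] {X : Type v} [CommGroup X] (x : LieD F X)
    (h : X) : F :=
  (x : Module.Dual F (MonoidAlgebra F X)) (MonoidAlgebra.of F X h)

/-- The coordinate superalgebra `F[D_{1,x}] = FX ⊕ (FX)z` with `z` odd, `z² = 0`. (As a
superalgebra it does not depend on `x`; the coproduct does.) -/
abbrev CoordD (F : Type u) [Field F] (X : Type v) [CommGroup X] : Type max u v :=
  DualNumber (MonoidAlgebra F X)

namespace CoordD

/-- A character `h ∈ X`, as an element of `F[D_{1,x}]`. -/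
noncomputable def chr (F : Type u) [Field F] {X : Type v} [CommGroup X] (h : X) : CoordD F X :=
  TrivSqZeroExt.inl (MonoidAlgebra.of F X h)

/-- The odd element `z`. -/
noncomputable def z (F : Type u) [Field F] (X : Type v) [CommGroup X] : CoordD F X :=
  DualNumber.eps

theorem z_mul_z (F : Type u) [Field F] (X : Type v) [CommGroup X] : z F X * z F X = 0 :=
  DualNumber.eps_mul_eps

theorem chr_one (F : Type u) [Field F] (X : Type v) [CommGroup X] : chr F (1 : X) = 1 := by
  rw [chr, map_one, TrivSqZeroExt.inl_one]

theorem chr_mul (F : Type u) [Field F] {X : Type v} [CommGroup X] (h k : X) :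
    chr F (h * k) = chr F h * chr F k := by
  rw [chr, map_mul, TrivSqZeroExt.inl_mul, chr, chr]

/-- The parity grading: the even part is `FX`, the odd part is `(FX)z`. -/
noncomputable def parity (F : Type u) [Field F] (X : Type v) [CommGroup X] (i : ZMod 2) :
    Submodule F (CoordD F X) where
  carrier := {b | (i = 0 → b.snd = 0) ∧ (i = 1 → b.fst = 0)}
  add_mem' {a b} ha hb := ⟨fun h => by simp [ha.1 h, hb.1 h], fun h => by simp [ha.2 h, hb.2 h]⟩
  zero_mem' := ⟨fun _ => rfl, fun _ => rfl⟩
  smul_mem' c b hb := ⟨fun h => by simp [hb.1 h], fun h => by simp [hb.2 h]⟩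

theorem chr_mem (F : Type u) [Field F] {X : Type v} [CommGroup X] (h : X) :
    chr F h ∈ parity F X 0 :=
  ⟨fun _ => TrivSqZeroExt.snd_inl _ _, fun h => absurd h (by decide)⟩

theorem z_mem (F : Type u) [Field F] (X : Type v) [CommGroup X] : z F X ∈ parity F X 1 :=
  ⟨fun h => absurd h (by decide), fun _ => TrivSqZeroExt.fst_inr _ _⟩

noncomputable instance gradedMonoid_parity (F : Type u) [Field F] (X : Type v) [CommGroup X] :
    SetLike.GradedMonoid (parity F X) where
  one_mem := ⟨fun _ => TrivSqZeroExt.snd_one, fun h => absurd h (by decide)⟩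
  mul_mem i j a b ha hb := by
    have h01 : ∀ k : ZMod 2, k = 0 ∨ k = 1 := by decide
    rcases h01 i with rfl | rfl <;> rcases h01 j with rfl | rfl
    · exact ⟨fun _ => by simp [ha.1 rfl, hb.1 rfl], fun h => absurd h (by decide)⟩
    · exact ⟨fun h => absurd h (by decide), fun _ => by simp [hb.2 rfl]⟩
    · exact ⟨fun h => absurd h (by decide), fun _ => by simp [ha.2 rfl]⟩
    · exact ⟨fun _ => by simp [ha.2 rfl, hb.2 rfl], fun h => absurd h (by decide)⟩

/-- The projection of `F[D_{1,x}]` onto its even part `FX`. -/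
noncomputable def evenPart (F : Type u) [Field F] (X : Type v) [CommGroup X] :
    CoordD F X →ₗ[F] parity F X 0 where
  toFun b := ⟨TrivSqZeroExt.inl b.fst, fun _ => TrivSqZeroExt.snd_inl _ _,
    fun h => absurd h (by decide)⟩
  map_add' a b := Subtype.ext (by simp)
  map_smul' c b := Subtype.ext (by simp)

/-- The projection of `F[D_{1,x}]` onto its odd part `(FX)z`. -/
noncomputable def oddPart (F : Type u) [Field F] (X : Type v) [CommGroup X] :
    CoordD F X →ₗ[F] parity F X 1 where
  toFun b := ⟨TrivSqZeroExt.inr b.snd, fun h => absurd h (by decide),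
    fun _ => TrivSqZeroExt.fst_inr _ _⟩
  map_add' a b := Subtype.ext (TrivSqZeroExt.inr_add _ _ _)
  map_smul' c b := Subtype.ext (by simp)

noncomputable instance decomposition_parity (F : Type u) [Field F] (X : Type v) [CommGroup X] :
    DirectSum.Decomposition (parity F X) :=
  DirectSum.Decomposition.ofLinearMap (parity F X)
    (DirectSum.lof F (ZMod 2) (fun i => parity F X i) 0 ∘ₗ evenPart F X +
      DirectSum.lof F (ZMod 2) (fun i => parity F X i) 1 ∘ₗ oddPart F X)
    (by
      ext1 b
      rw [LinearMap.comp_apply, LinearMap.add_apply, map_add, LinearMap.comp_apply,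
        LinearMap.comp_apply, DirectSum.coeLinearMap_lof, DirectSum.coeLinearMap_lof]
      exact TrivSqZeroExt.inl_fst_add_inr_snd_eq b)
    (by
      have h01 : ∀ k : ZMod 2, k = 0 ∨ k = 1 := by decide
      refine DirectSum.linearMap_ext F fun i => ?_
      ext1 b
      rw [LinearMap.comp_apply, LinearMap.comp_apply, DirectSum.coeLinearMap_lof,
        LinearMap.add_apply, LinearMap.comp_apply, LinearMap.comp_apply]
      obtain ⟨b, hb⟩ := b
      rcases h01 i with rfl | rfl
      · have h0 : evenPart F X b = ⟨b, hb⟩ :=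
          Subtype.ext (TrivSqZeroExt.ext rfl (by simpa [evenPart] using (hb.1 rfl).symm))
        have h1 : oddPart F X b = 0 := Subtype.ext (by simp [oddPart, hb.1 rfl])
        simp only [h0, h1, map_zero, add_zero]
        rfl
      · have h0 : evenPart F X b = 0 := Subtype.ext (by simp [evenPart, hb.2 rfl])
        have h1 : oddPart F X b = ⟨b, hb⟩ :=
          Subtype.ext (TrivSqZeroExt.ext (by simpa [oddPart] using (hb.2 rfl).symm) rfl)
        simp only [h0, h1, map_zero, zero_add]
        rfl)

noncomputable instance gradedAlgebra_parity (F : Type u) [Field F] (X : Type v) [CommGroup X] :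
    GradedAlgebra (parity F X) where

/-- Multiplication in a graded tensor product, on homogeneous inner factors. -/
theorem tmul_mul_tmul {F : Type u} [Field F] {A : Type v} {B : Type w} [Ring A] [Ring B]
    [Algebra F A] [Algebra F B] {𝒜 : ZMod 2 → Submodule F A} {ℬ : ZMod 2 → Submodule F B}
    [GradedAlgebra 𝒜] [GradedAlgebra ℬ] {i j : ZMod 2} (a₁ : A) {b₁ : B} {a₂ : A} (b₂ : B)
    (hb : b₁ ∈ ℬ i) (ha : a₂ ∈ 𝒜 j) :
    ((a₁ ᵍ⊗ₜ[F] b₁ : 𝒜 ᵍ⊗[F] ℬ) * (a₂ ᵍ⊗ₜ[F] b₂ : 𝒜 ᵍ⊗[F] ℬ)) =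
      (-1 : ℤˣ) ^ (i * j) • ((a₁ * a₂) ᵍ⊗ₜ[F] (b₁ * b₂) : 𝒜 ᵍ⊗[F] ℬ) :=
  GradedTensorProduct.tmul_coe_mul_coe_tmul 𝒜 ℬ a₁ ⟨b₁, hb⟩ ⟨a₂, ha⟩ b₂

theorem tmul_zero {F : Type u} [Field F] {A : Type v} {B : Type w} [Ring A] [Ring B]
    [Algebra F A] [Algebra F B] {𝒜 : ZMod 2 → Submodule F A} {ℬ : ZMod 2 → Submodule F B}
    [GradedAlgebra 𝒜] [GradedAlgebra ℬ] (a : A) :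
    (a ᵍ⊗ₜ[F] (0 : B) : 𝒜 ᵍ⊗[F] ℬ) = 0 := by
  rw [GradedTensorProduct.tmul, TensorProduct.tmul_zero, map_zero]

theorem zero_tmul {F : Type u} [Field F] {A : Type v} {B : Type w} [Ring A] [Ring B]
    [Algebra F A] [Algebra F B] {𝒜 : ZMod 2 → Submodule F A} {ℬ : ZMod 2 → Submodule F B}
    [GradedAlgebra 𝒜] [GradedAlgebra ℬ] (b : B) :
    ((0 : A) ᵍ⊗ₜ[F] b : 𝒜 ᵍ⊗[F] ℬ) = 0 := by
  rw [GradedTensorProduct.tmul, TensorProduct.zero_tmul, map_zero]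

theorem neg_tmul {F : Type u} [Field F] {A : Type v} {B : Type w} [Ring A] [Ring B]
    [Algebra F A] [Algebra F B] {𝒜 : ZMod 2 → Submodule F A} {ℬ : ZMod 2 → Submodule F B}
    [GradedAlgebra 𝒜] [GradedAlgebra ℬ] (a : A) (b : B) :
    ((-a) ᵍ⊗ₜ[F] b : 𝒜 ᵍ⊗[F] ℬ) = -(a ᵍ⊗ₜ[F] b) := by
  rw [GradedTensorProduct.tmul, TensorProduct.neg_tmul, map_neg]

/-- `F[D_{1,x}] ⊗ F[D_{1,x}]`, with `(a ⊗ b)(c ⊗ d) = (-1)^{|b||c|} ac ⊗ bd`. -/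
abbrev Tensor2 (F : Type u) [Field F] (X : Type v) [CommGroup X] : Type max u v :=
  parity F X ᵍ⊗[F] parity F X

theorem chr_mul_z_mem (F : Type u) [Field F] {X : Type v} [CommGroup X] (h : X) :
    chr F h * z F X ∈ parity F X 1 := by
  simpa using SetLike.GradedMul.mul_mem (chr_mem F h) (z_mem F X)

/-- `Δ(h) = h ⊗ h + x(h) hz ⊗ hz`, for `h ∈ X`. -/
noncomputable def comulChr {F : Type u} [Field F] {X : Type v} [CommGroup X] (x : LieD F X)
    (h : X) : Tensor2 F X :=
  chr F h ᵍ⊗ₜ[F] chr F h + LieD.eval x h • ((chr F h * z F X) ᵍ⊗ₜ[F] (chr F h * z F X))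

/-- `Δ(z) = 1 ⊗ z + z ⊗ 1`. -/
noncomputable def comulZ (F : Type u) [Field F] (X : Type v) [CommGroup X] : Tensor2 F X :=
  1 ᵍ⊗ₜ[F] z F X + z F X ᵍ⊗ₜ[F] 1

end CoordD

theorem LieD.eval_one {F : Type u} [Field F] {X : Type v} [CommGroup X] (x : LieD F X) :
    LieD.eval x 1 = 0 := by
  have h := x.2 1 1
  rw [mul_one] at h
  exact left_eq_add.mp h

theorem LieD.eval_mul {F : Type u} [Field F] {X : Type v} [CommGroup X] (x : LieD F X) (h k : X) :
    LieD.eval x (h * k) = LieD.eval x h + LieD.eval x k :=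
  x.2 h k

namespace CoordD

theorem comulChr_mul {F : Type u} [Field F] {X : Type v} [CommGroup X] (x : LieD F X) (h k : X) :
    comulChr x (h * k) = comulChr x h * comulChr x k := by
  have e1 : chr F h * z F X * (chr F k * z F X) = 0 := by
    rw [mul_mul_mul_comm, z_mul_z, mul_zero]
  have e2 : chr F h * (chr F k * z F X) = chr F (h * k) * z F X := by rw [chr_mul, mul_assoc]
  have e3 : chr F h * z F X * chr F k = chr F (h * k) * z F X := by rw [chr_mul, mul_right_comm]
  unfold comulChr
  rw [add_mul, mul_add, mul_add, smul_mul_smul_comm, smul_mul_assoc, mul_smul_comm,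
    tmul_mul_tmul _ _ (chr_mem F h) (chr_mem F k),
    tmul_mul_tmul _ _ (chr_mem F h) (chr_mul_z_mem F k),
    tmul_mul_tmul _ _ (chr_mul_z_mem F h) (chr_mem F k),
    tmul_mul_tmul _ _ (chr_mul_z_mem F h) (chr_mul_z_mem F k), e1, e2, e3, ← chr_mul,
    LieD.eval_mul]
  simp only [mul_zero, zero_mul, uzpow_zero, one_smul, zero_tmul, smul_zero,
    add_zero, add_smul]
  abel

theorem comulChr_one {F : Type u} [Field F] {X : Type v} [CommGroup X] (x : LieD F X) :
    comulChr x 1 = 1 := by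
  rw [comulChr, LieD.eval_one, zero_smul, add_zero, chr_one]
  rfl

theorem comulZ_mul_comulZ (F : Type u) [Field F] (X : Type v) [CommGroup X] :
    comulZ F X * comulZ F X = 0 := by
  have h1 : (1 : CoordD F X) ∈ parity F X 0 := SetLike.GradedOne.one_mem
  unfold comulZ
  rw [add_mul, mul_add, mul_add, tmul_mul_tmul _ _ (z_mem F X) h1,
    tmul_mul_tmul _ _ (z_mem F X) (z_mem F X), tmul_mul_tmul _ _ h1 h1,
    tmul_mul_tmul _ _ h1 (z_mem F X), z_mul_z]
  simp [tmul_zero, zero_tmul]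

theorem comulZ_comm {F : Type u} [Field F] {X : Type v} [CommGroup X] (x : LieD F X) (h : X) :
    comulZ F X * comulChr x h = comulChr x h * comulZ F X := by
  have h1 : (1 : CoordD F X) ∈ parity F X 0 := SetLike.GradedOne.one_mem
  have e1 : z F X * (chr F h * z F X) = 0 := by rw [mul_left_comm, z_mul_z, mul_zero]
  have e2 : chr F h * z F X * z F X = 0 := by rw [mul_assoc, z_mul_z, mul_zero]
  unfold comulZ comulChr
  rw [add_mul, mul_add, mul_add, add_mul, mul_add, mul_add]
  simp only [smul_mul_assoc, mul_smul_comm]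
  rw [tmul_mul_tmul _ _ (z_mem F X) (chr_mem F h),
    tmul_mul_tmul _ _ (z_mem F X) (chr_mul_z_mem F h),
    tmul_mul_tmul _ _ h1 (chr_mem F h), tmul_mul_tmul _ _ h1 (chr_mul_z_mem F h),
    tmul_mul_tmul _ _ (chr_mem F h) h1, tmul_mul_tmul _ _ (chr_mem F h) (z_mem F X),
    tmul_mul_tmul _ _ (chr_mul_z_mem F h) h1, tmul_mul_tmul _ _ (chr_mul_z_mem F h) (z_mem F X),
    e1, e2, mul_comm (z F X) (chr F h)]
  simp [tmul_zero, zero_tmul]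

/-- The coproduct of the supergroup `D_{1,x}`: the superalgebra homomorphism with
`Δ(h) = h ⊗ h + x(h) hz ⊗ hz` for `h ∈ X` and `Δ(z) = 1 ⊗ z + z ⊗ 1`. -/
noncomputable def comul {F : Type u} [Field F] {X : Type v} [CommGroup X] (x : LieD F X) :
    CoordD F X →ₐ[F] Tensor2 F X :=
  DualNumber.lift
    ⟨(MonoidAlgebra.lift F (Tensor2 F X) X
        { toFun := comulChr x
          map_one' := comulChr_one x
          map_mul' := comulChr_mul x }, comulZ F X), comulZ_mul_comulZ F X, by
      intro a
      induction a using MonoidAlgebra.induction_on with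
      | of h =>
        rw [MonoidAlgebra.lift_of]
        exact comulZ_comm x h
      | add a b ha hb =>
        rw [map_add]
        exact ha.add_right hb
      | smul c a ha =>
        rw [map_smul]
        exact ha.smul_right c⟩

theorem comul_chr {F : Type u} [Field F] {X : Type v} [CommGroup X] (x : LieD F X) (h : X) :
    comul x (chr F h) = comulChr x h := by
  rw [comul, chr, DualNumber.lift_apply_inl, MonoidAlgebra.lift_of]
  rfl

theorem comul_z {F : Type u} [Field F] {X : Type v} [CommGroup X] (x : LieD F X) :
    comul x (z F X) = comulZ F X := by
  rw [comul, z, DualNumber.lift_apply_eps]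

theorem comul_chr_mul_z {F : Type u} [Field F] {X : Type v} [CommGroup X] (x : LieD F X)
    (h : X) : comul x (chr F h * z F X) =
      chr F h ᵍ⊗ₜ[F] (chr F h * z F X) + (chr F h * z F X) ᵍ⊗ₜ[F] chr F h := by
  have h1 : (1 : CoordD F X) ∈ parity F X 0 := SetLike.GradedOne.one_mem
  have e2 : chr F h * z F X * z F X = 0 := by rw [mul_assoc, z_mul_z, mul_zero]
  rw [map_mul, comul_chr, comul_z, comulChr, comulZ, add_mul, mul_add, mul_add]
  simp only [smul_mul_assoc]
  rw [tmul_mul_tmul _ _ (chr_mem F h) h1, tmul_mul_tmul _ _ (chr_mem F h) (z_mem F X),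
    tmul_mul_tmul _ _ (chr_mul_z_mem F h) h1, tmul_mul_tmul _ _ (chr_mul_z_mem F h) (z_mem F X),
    e2]
  simp [tmul_zero, zero_tmul]

end CoordD

/-! ### The superalgebra `F[V]` and its coaction -/

/-- The polynomial superalgebra `F[V]`, for a `D_{1,x}`-supermodule `V` with
`V* ≅ L(h₁) ⊕ ⋯ ⊕ L(h_s)`. It is freely generated by even elements `f_{j,0}` and odd elements
`f_{j,1}`, for `1 ≤ j ≤ s`; the generator `f_{j,a}` has index `(j, a)`. -/
abbrev FV (F : Type u) [Field F] (s : ℕ) : Type u :=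
  SuperPoly F (fun k : Fin s × ZMod 2 => k.2)

namespace FV

/-- The generator `f_{j,a}`. -/
noncomputable def f (F : Type u) [Field F] {s : ℕ} (j : Fin s) (a : ZMod 2) : FV F s :=
  SuperPoly.gen F (fun k : Fin s × ZMod 2 => k.2) (j, a)

/-- The parity grading of `F[V]`. -/
noncomputable abbrev parity (F : Type u) [Field F] (s : ℕ) : ZMod 2 → Submodule F (FV F s) :=
  SuperPoly.homog F (fun k : Fin s × ZMod 2 => k.2) (fun k : Fin s × ZMod 2 => k.2)

/-- The homogeneous component `F[V]_d` of degree `d`; all the `f_{j,a}` have degree one. -/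
noncomputable abbrev degree (F : Type u) [Field F] (s : ℕ) : ℕ → Submodule F (FV F s) :=
  SuperPoly.homog F (fun k : Fin s × ZMod 2 => k.2) (fun _ => 1)

theorem f_mem (F : Type u) [Field F] {s : ℕ} (j : Fin s) (a : ZMod 2) : f F j a ∈ parity F s a :=
  SuperPoly.gen_mem_homog F _ _ (j, a)

/-- The linear map that carries the basis `f₀ = h`, `f₁ = hz` of the direct summand `L(h)` of
`F[D_{1,x}]` to the copy `f_{j,0}, f_{j,1}` of it in `V*`, and that vanishes on the other
summands `L(h')`. -/
noncomputable def ofL (F : Type u) [Field F] {X : Type v} [CommGroup X] {s : ℕ} (h : X)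
    (j : Fin s) : CoordD F X →ₗ[F] FV F s where
  toFun b := b.fst.coeff h • f F j 0 + b.snd.coeff h • f F j 1
  map_add' a b := by
    simp only [TrivSqZeroExt.fst_add, TrivSqZeroExt.snd_add, MonoidAlgebra.coeff_add,
      Finsupp.add_apply, add_smul]
    abel
  map_smul' c b := by
    simp only [TrivSqZeroExt.fst_smul, TrivSqZeroExt.snd_smul, MonoidAlgebra.coeff_smul,
      Finsupp.smul_apply, smul_add, smul_smul, smul_eq_mul, RingHom.id_apply]

theorem ofL_apply (F : Type u) [Field F] {X : Type v} [CommGroup X] {s : ℕ} (h : X)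
    (j : Fin s) (b : CoordD F X) :
    ofL F h j b = b.fst.coeff h • f F j 0 + b.snd.coeff h • f F j 1 := rfl

theorem ofL_chr (F : Type u) [Field F] {X : Type v} [CommGroup X] {s : ℕ} (h : X)
    (j : Fin s) : ofL F h j (CoordD.chr F h) = f F j 0 := by
  rw [ofL_apply, CoordD.chr, TrivSqZeroExt.fst_inl, TrivSqZeroExt.snd_inl]
  simp

theorem ofL_chr_mul_z (F : Type u) [Field F] {X : Type v} [CommGroup X] {s : ℕ} (h : X)
    (j : Fin s) : ofL F h j (CoordD.chr F h * CoordD.z F X) = f F j 1 := by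
  rw [ofL_apply, CoordD.chr, CoordD.z, TrivSqZeroExt.fst_mul, TrivSqZeroExt.snd_mul,
    TrivSqZeroExt.fst_inl, TrivSqZeroExt.snd_inl, DualNumber.fst_eps, DualNumber.snd_eps]
  simp

/-- `F[V] ⊗ F[D_{1,x}]`, with `(a ⊗ b)(c ⊗ d) = (-1)^{|b||c|} ac ⊗ bd`. -/
abbrev Target (F : Type u) [Field F] (X : Type v) [CommGroup X] (s : ℕ) : Type max u v :=
  parity F s ᵍ⊗[F] CoordD.parity F X

/-- The coaction on the generators: the coaction of the subcomodule `L(h_j)` of `F[D_{1,x}]`,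
which is the restriction of the coproduct. -/
noncomputable def coactGen {F : Type u} [Field F] {X : Type v} [CommGroup X] (x : LieD F X)
    {s : ℕ} (h : Fin s → X) (k : Fin s × ZMod 2) : Target F X s :=
  GradedTensorProduct.of F (parity F s) (CoordD.parity F X)
    (TensorProduct.map (ofL F (h k.1) k.1) LinearMap.id
      ((GradedTensorProduct.of F (CoordD.parity F X) (CoordD.parity F X)).symm
        (CoordD.comul x (CoordD.chr F (h k.1) * CoordD.z F X ^ k.2.val))))

theorem coactGen_zero {F : Type u} [Field F] {X : Type v} [CommGroup X] (x : LieD F X)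
    {s : ℕ} (h : Fin s → X) (j : Fin s) :
    coactGen x h (j, 0) = f F j 0 ᵍ⊗ₜ[F] CoordD.chr F (h j) +
      LieD.eval x (h j) • (f F j 1 ᵍ⊗ₜ[F] (CoordD.chr F (h j) * CoordD.z F X)) := by
  rw [coactGen, ZMod.val_zero, pow_zero, mul_one, CoordD.comul_chr, CoordD.comulChr, map_add,
    map_smul, GradedTensorProduct.of_symm_of, GradedTensorProduct.of_symm_of, map_add, map_smul,
    TensorProduct.map_tmul, TensorProduct.map_tmul, ofL_chr, ofL_chr_mul_z, map_add, map_smul]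
  rfl

theorem coactGen_one {F : Type u} [Field F] {X : Type v} [CommGroup X] (x : LieD F X)
    {s : ℕ} (h : Fin s → X) (j : Fin s) :
    coactGen x h (j, 1) = f F j 0 ᵍ⊗ₜ[F] (CoordD.chr F (h j) * CoordD.z F X) +
      f F j 1 ᵍ⊗ₜ[F] CoordD.chr F (h j) := by
  rw [coactGen, ZMod.val_one, pow_one, CoordD.comul_chr_mul_z, map_add,
    GradedTensorProduct.of_symm_of, GradedTensorProduct.of_symm_of, map_add,
    TensorProduct.map_tmul, TensorProduct.map_tmul, ofL_chr, ofL_chr_mul_z, map_add]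
  rfl

theorem coactGen_eq {F : Type u} [Field F] {X : Type v} [CommGroup X] (x : LieD F X)
    {s : ℕ} (h : Fin s → X) (j : Fin s) (a : ZMod 2) :
    ∃ c : F, coactGen x h (j, a) = f F j a ᵍ⊗ₜ[F] CoordD.chr F (h j) +
      c • (f F j (a + 1) ᵍ⊗ₜ[F] (CoordD.chr F (h j) * CoordD.z F X)) := by
  have h01 : a = 0 ∨ a = 1 := by revert a; decide
  rcases h01 with rfl | rfl
  · exact ⟨_, coactGen_zero x h j⟩
  · exact ⟨1, by rw [coactGen_one, one_smul, add_comm]; rfl⟩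

theorem coactGen_comm {F : Type u} [Field F] {X : Type v} [CommGroup X] (x : LieD F X)
    {s : ℕ} (h : Fin s → X) (k l : Fin s × ZMod 2) :
    coactGen x h k * coactGen x h l =
      (-1 : ℤˣ) ^ (k.2 * l.2) • (coactGen x h l * coactGen x h k) := by
  obtain ⟨i, a⟩ := k
  obtain ⟨j, b⟩ := l
  obtain ⟨c, hc⟩ := coactGen_eq x h i a
  obtain ⟨d, hd⟩ := coactGen_eq x h j b
  have e1 : ∀ p q : X, CoordD.chr F p * CoordD.z F X * (CoordD.chr F q * CoordD.z F X) = 0 := by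
    intro p q
    rw [mul_mul_mul_comm, CoordD.z_mul_z, mul_zero]
  have e2 : ∀ p q : X, CoordD.chr F p * (CoordD.chr F q * CoordD.z F X) =
      CoordD.chr F (p * q) * CoordD.z F X := by
    intro p q
    rw [CoordD.chr_mul, mul_assoc]
  have e3 : ∀ p q : X, CoordD.chr F p * CoordD.z F X * CoordD.chr F q =
      CoordD.chr F (p * q) * CoordD.z F X := by
    intro p q
    rw [CoordD.chr_mul, mul_right_comm]
  have g : ∀ a b : ZMod 2, f F i a * f F j b = (-1 : ℤˣ) ^ (a * b) • (f F j b * f F i a) :=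
    fun a b => SuperPoly.gen_mul_gen F _ (i, a) (j, b)
  have u : (-1 : ℤˣ) ^ ((1 : ZMod 2) + 1) = 1 := by
    rw [show (1 : ZMod 2) + 1 = 0 from rfl, uzpow_zero]
  rw [hc, hd, add_mul, mul_add, mul_add, add_mul, mul_add, mul_add]
  simp only [smul_mul_assoc, mul_smul_comm]
  rw [CoordD.tmul_mul_tmul _ _ (CoordD.chr_mem F (h i)) (f_mem F j b),
    CoordD.tmul_mul_tmul _ _ (CoordD.chr_mem F (h i)) (f_mem F j (b + 1)),
    CoordD.tmul_mul_tmul _ _ (CoordD.chr_mul_z_mem F (h i)) (f_mem F j b),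
    CoordD.tmul_mul_tmul _ _ (CoordD.chr_mul_z_mem F (h i)) (f_mem F j (b + 1)),
    CoordD.tmul_mul_tmul _ _ (CoordD.chr_mem F (h j)) (f_mem F i a),
    CoordD.tmul_mul_tmul _ _ (CoordD.chr_mem F (h j)) (f_mem F i (a + 1)),
    CoordD.tmul_mul_tmul _ _ (CoordD.chr_mul_z_mem F (h j)) (f_mem F i a),
    CoordD.tmul_mul_tmul _ _ (CoordD.chr_mul_z_mem F (h j)) (f_mem F i (a + 1)),
    e1, e1, e2, e2, e3, e3, ← CoordD.chr_mul, ← CoordD.chr_mul, mul_comm (h j) (h i),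
    g a b, g a (b + 1), g (a + 1) b]
  have h01 : ∀ a : ZMod 2, a = 0 ∨ a = 1 := by decide
  rcases h01 a with rfl | rfl <;> rcases h01 b with rfl | rfl
  all_goals
    simp [CoordD.tmul_zero, CoordD.neg_tmul, u]
    abel

/-- The coaction `τ : F[V] → F[V] ⊗ F[D_{1,x}]`: the superalgebra homomorphism with
`τ(f_{j,0}) = f_{j,0} ⊗ h_j + x(h_j) f_{j,1} ⊗ h_j z` and
`τ(f_{j,1}) = f_{j,0} ⊗ h_j z + f_{j,1} ⊗ h_j`. -/
noncomputable def coact {F : Type u} [Field F] {X : Type v} [CommGroup X] (x : LieD F X)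
    {s : ℕ} (h : Fin s → X) : FV F s →ₐ[F] Target F X s :=
  SuperPoly.lift _ (coactGen x h) (coactGen_comm x h)

theorem coact_f_zero {F : Type u} [Field F] {X : Type v} [CommGroup X] (x : LieD F X)
    {s : ℕ} (h : Fin s → X) (j : Fin s) :
    coact x h (f F j 0) = f F j 0 ᵍ⊗ₜ[F] CoordD.chr F (h j) +
      LieD.eval x (h j) • (f F j 1 ᵍ⊗ₜ[F] (CoordD.chr F (h j) * CoordD.z F X)) :=
  (SuperPoly.lift_gen _ _ _ _).trans (coactGen_zero x h j)

theorem coact_f_one {F : Type u} [Field F] {X : Type v} [CommGroup X] (x : LieD F X)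
    {s : ℕ} (h : Fin s → X) (j : Fin s) :
    coact x h (f F j 1) = f F j 0 ᵍ⊗ₜ[F] (CoordD.chr F (h j) * CoordD.z F X) +
      f F j 1 ᵍ⊗ₜ[F] CoordD.chr F (h j) :=
  (SuperPoly.lift_gen _ _ _ _).trans (coactGen_one x h j)

/-- The coaction as a linear map to the plain tensor product. -/
noncomputable def coactLin {F : Type u} [Field F] {X : Type v} [CommGroup X] (x : LieD F X)
    {s : ℕ} (h : Fin s → X) : FV F s →ₗ[F] FV F s ⊗[F] CoordD F X :=
  (GradedTensorProduct.of F (parity F s) (CoordD.parity F X)).symm.toLinearMap ∘ₗ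
    (coact x h).toLinearMap

/-- The invariants `F[V]^{D_{1,x}}`: all `a ∈ F[V]` with `τ(a) = a ⊗ 1`. -/
noncomputable def invariants {F : Type u} [Field F] {X : Type v} [CommGroup X] (x : LieD F X)
    {s : ℕ} (h : Fin s → X) : Submodule F (FV F s) :=
  LinearMap.eqLocus (coactLin x h) ((TensorProduct.mk F (FV F s) (CoordD F X)).flip 1)

/-- The restriction `τ|_D : F[V] → F[V] ⊗ FX` of the coaction to `D`, the largest even
subsupergroup of `D_{1,x}`, which is given by the ideal generated by `z`. -/
noncomputable def coactD {F : Type u} [Field F] {X : Type v} [CommGroup X] (x : LieD F X)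
    {s : ℕ} (h : Fin s → X) : FV F s →ₗ[F] FV F s ⊗[F] MonoidAlgebra F X :=
  TensorProduct.map LinearMap.id
    (TrivSqZeroExt.fstHom F (MonoidAlgebra F X) (MonoidAlgebra F X)).toLinearMap ∘ₗ coactLin x h

/-- The invariants `F[V]^D`: all `a ∈ F[V]` with `τ|_D(a) = a ⊗ 1`. -/
noncomputable def invariantsD {F : Type u} [Field F] {X : Type v} [CommGroup X] (x : LieD F X)
    {s : ℕ} (h : Fin s → X) : Submodule F (FV F s) :=
  LinearMap.eqLocus (coactD x h) ((TensorProduct.mk F (FV F s) (MonoidAlgebra F X)).flip 1)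

/-- The odd element `φ` of `Lie(D_{1,x})`, as a functional on `F[D_{1,x}]`: `φ(h) = 0` and
`φ(hz) = 1` for `h ∈ X`. -/
noncomputable def phiFunctional (F : Type u) [Field F] (X : Type v) [CommGroup X] :
    CoordD F X →ₗ[F] F where
  toFun b := MonoidAlgebra.lift F F X 1 b.snd
  map_add' a b := by rw [TrivSqZeroExt.snd_add, map_add]
  map_smul' c b := by rw [TrivSqZeroExt.snd_smul, map_smul, RingHom.id_apply]

/-- The action of `φ` on `F[V]`: the composite of the coaction with `id ⊗ φ`. -/
noncomputable def phi {F : Type u} [Field F] {X : Type v} [CommGroup X] (x : LieD F X)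
    {s : ℕ} (h : Fin s → X) : FV F s →ₗ[F] FV F s :=
  (TensorProduct.rid F (FV F s)).toLinearMap ∘ₗ
    TensorProduct.map LinearMap.id (phiFunctional F X) ∘ₗ coactLin x h

/-- The minimal positive degree of a nonzero homogeneous element of a subspace of `F[V]`, and `⊤`
if there is none. For the invariants of a (super)group `G` this is `M_{G,V}`. -/
noncomputable def minDegree {F : Type u} [Field F] {s : ℕ} (A : Submodule F (FV F s)) : ℕ∞ :=
  ⨅ d ∈ {d : ℕ | 0 < d ∧ A ⊓ degree F s d ≠ ⊥}, (d : ℕ∞)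

/-- `{v_i}`, for `i ∈ I₁ ⊔ I₂`, is a homogeneous basis of the graded subspace `A`, such that the
`v_i` with `i ∈ I₁` form a basis of `φA` (hence those with `i ∈ I₂` form a basis modulo `φA`). -/
structure IsAdaptedBasis {F : Type u} [Field F] {s : ℕ} (A : Submodule F (FV F s))
    (φ : FV F s →ₗ[F] FV F s) {I₁ I₂ : Type w} (b : I₁ ⊕ I₂ → FV F s) : Prop where
  homogeneous : ∀ i, ∃ d, b i ∈ degree F s d
  linearIndependent : LinearIndependent F b
  span_eq : Submodule.span F (Set.range b) = A
  span_image : Submodule.span F (Set.range (b ∘ Sum.inl)) = A.map φ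

/-- `C = (c_{ij})`, for `i ∈ I₂` and `j ∈ I₁`, is row-finite, with `φ v_i = ∑_j c_{ij} v_j`. -/
def IsCoeffMatrix {F : Type u} [Field F] {s : ℕ} (φ : FV F s →ₗ[F] FV F s) {I₁ I₂ : Type w}
    (b : I₁ ⊕ I₂ → FV F s) (C : Matrix I₂ I₁ F) : Prop :=
  ∀ i, {j | C i j ≠ 0}.Finite ∧ φ (b (Sum.inr i)) = ∑ᶠ j, C i j • b (Sum.inl j)

end FV

/-! The whole argument rests on one formula. A product `a` of generators has a weight `g` in `X`,
the product of the corresponding `h_j`, and `τ(a) = a ⊗ g + φ(a) ⊗ gz` (`coact_monomial`). Since `τ`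
is multiplicative and `z² = 0`, comparing the coefficients of `gz` in a product gives the Leibniz
rule with its sign (`phi_mul`). As `f_{j,0}` and `f_{j,1}` share both weight and degree, `φ`
preserves weights and degrees (`phi_mem_homog`).

The square of an odd superderivation is an even derivation. On both `f_{j,0}` and `f_{j,1}`, `φ²` is
multiplication by `x(h_j)`, so on weight `g` it is multiplication by `x(g)` (`phi_phi_monomial`).
The algebra `A = F[V]^D` is the component of weight `1`, and `x(1) = 0`; hence `φ` is a differential
on `A`. There the formula reads `τ(a) = a ⊗ 1 + φ(a) ⊗ z`, so the invariants of `D_{1,x}` are the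
kernel of this differential (`mem_invariants_iff`).

The rest is linear algebra. The kernel contains the image `φA`, and modulo `φA` it is the left null
space of the matrix `C` (`IsAdaptedBasis.inf_ker_eq_span`). If `a` is a nonzero element of `A` of
degree `d`, then either `φ(a) = 0` and `a` is invariant, or `φ(a)` is a nonzero invariant of degree
`d`; so the minimal degrees agree. -/

namespace FV

variable {F : Type u} [Field F] {X : Type v} [CommGroup X]

/-! ### Monomials and their weights -/

/-- The product of the generators in a list. -/
noncomputable def monomial (F : Type u) [Field F] {s : ℕ} (l : List (Fin s × ZMod 2)) : FV F s :=
  (l.map (SuperPoly.gen F fun k : Fin s × ZMod 2 => k.2)).prod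

/-- The character by which `D` acts on a product of generators. -/
def weight {s : ℕ} (h : Fin s → X) (l : List (Fin s × ZMod 2)) : X :=
  (l.map fun k => h k.1).prod

theorem monomial_mem_homog {s : ℕ} {M : Type w} [AddCommMonoid M] (W : Fin s × ZMod 2 → M)
    (l : List (Fin s × ZMod 2)) :
    monomial F l ∈ SuperPoly.homog F (fun k : Fin s × ZMod 2 => k.2) W (l.map W).sum :=
  Submodule.subset_span ⟨l, rfl, rfl⟩

theorem monomial_cons {s : ℕ} (j : Fin s) (a : ZMod 2) (l : List (Fin s × ZMod 2)) :
    monomial F ((j, a) :: l) = f F j a * monomial F l := rfl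

/-- For the grading by the one-element monoid all monomials lie in a single component, and the
decomposition into components forces it to be everything. -/
theorem span_range_monomial (F : Type u) [Field F] (s : ℕ) :
    Submodule.span F (Set.range (monomial F (s := s))) = ⊤ := by
  have hW : Submodule.span F (Set.range (monomial F (s := s))) =
      SuperPoly.homog F (fun k : Fin s × ZMod 2 => k.2) (fun _ => (0 : PUnit)) 0 := by
    rw [SuperPoly.homog]
    congr 1
    ext a
    constructor
    · rintro ⟨l, rfl⟩
      exact ⟨l, rfl, rfl⟩
    · rintro ⟨l, -, rfl⟩
      exact ⟨l, rfl⟩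
  rw [hW, eq_top_iff]
  rintro a -
  classical
  have := DirectSum.sum_support_decompose
    (SuperPoly.homog F (fun k : Fin s × ZMod 2 => k.2) (fun _ => (0 : PUnit))) a
  rw [← this]
  exact Submodule.sum_mem _ fun i _ => SetLike.coe_mem _

/-- This is the source of the Leibniz rule. The sign comes from moving the odd `gz` past `b`; moving
the even `g` costs none, and the fourth product vanishes because `z² = 0`. The parity of `b'` does
not affect the result: its homogeneity only makes the graded product formula applicable. -/
theorem tmul_mul_tmul_add {s : ℕ} {i : ZMod 2} (a a' : FV F s) {b b' : FV F s} (g k : X)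
    (hb : b ∈ parity F s i) (hb' : b' ∈ parity F s (i + 1)) :
    ((a ᵍ⊗ₜ[F] CoordD.chr F g + a' ᵍ⊗ₜ[F] (CoordD.chr F g * CoordD.z F X)) *
      (b ᵍ⊗ₜ[F] CoordD.chr F k + b' ᵍ⊗ₜ[F] (CoordD.chr F k * CoordD.z F X)) : Target F X s) =
    (a * b) ᵍ⊗ₜ[F] CoordD.chr F (g * k) +
      (a * b' + (-1 : ℤˣ) ^ i • (a' * b)) ᵍ⊗ₜ[F] (CoordD.chr F (g * k) * CoordD.z F X) := by
  have e1 : CoordD.chr F g * CoordD.z F X * (CoordD.chr F k * CoordD.z F X) = 0 := by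
    rw [mul_mul_mul_comm, CoordD.z_mul_z, mul_zero]
  have e2 : CoordD.chr F g * (CoordD.chr F k * CoordD.z F X) =
      CoordD.chr F (g * k) * CoordD.z F X := by
    rw [CoordD.chr_mul, mul_assoc]
  have e3 : CoordD.chr F g * CoordD.z F X * CoordD.chr F k =
      CoordD.chr F (g * k) * CoordD.z F X := by
    rw [CoordD.chr_mul, mul_right_comm]
  have e4 : ∀ (ε : ℤˣ) (c : FV F s) (d : CoordD F X),
      (((ε • c) ᵍ⊗ₜ[F] d : Target F X s)) = ε • (c ᵍ⊗ₜ[F] d) := by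
    intro ε c d
    rcases Int.units_eq_one_or ε with rfl | rfl
    · simp
    · rw [Units.neg_smul, one_smul, CoordD.neg_tmul, Units.neg_smul, one_smul]
  have e5 : ∀ (c c' : FV F s) (d : CoordD F X),
      (((c + c') ᵍ⊗ₜ[F] d : Target F X s)) = c ᵍ⊗ₜ[F] d + c' ᵍ⊗ₜ[F] d := by
    intro c c' d
    rw [GradedTensorProduct.tmul, TensorProduct.add_tmul, map_add]
  rw [add_mul, mul_add, mul_add,
    CoordD.tmul_mul_tmul _ _ (CoordD.chr_mem F g) hb,
    CoordD.tmul_mul_tmul _ _ (CoordD.chr_mem F g) hb',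
    CoordD.tmul_mul_tmul _ _ (CoordD.chr_mul_z_mem F g) hb,
    CoordD.tmul_mul_tmul _ _ (CoordD.chr_mul_z_mem F g) hb', e1, e2, e3, ← CoordD.chr_mul,
    CoordD.tmul_zero, e5, e4]
  simp only [zero_mul, one_mul, uzpow_zero, one_smul, smul_zero, add_zero]
  abel

/-! ### Reading `φ` off the coaction -/

/-- If `τ(a) = a ⊗ g + a' ⊗ gz`, then `φ(a) = a'`. -/
theorem phi_eq_of_coact_eq (x : LieD F X) {s : ℕ} (h : Fin s → X) {a a' : FV F s} {g : X}
    (e : coact x h a =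
      a ᵍ⊗ₜ[F] CoordD.chr F g + a' ᵍ⊗ₜ[F] (CoordD.chr F g * CoordD.z F X)) :
    phi x h a = a' := by
  have e' : coactLin x h a =
      a ⊗ₜ[F] CoordD.chr F g + a' ⊗ₜ[F] (CoordD.chr F g * CoordD.z F X) := by
    change (GradedTensorProduct.of F (parity F s) (CoordD.parity F X)).symm (coact x h a) = _
    rw [e]
    rfl
  have h1 : phiFunctional F X (CoordD.chr F g) = 0 := by
    simp [phiFunctional, CoordD.chr]
  have h2 : phiFunctional F X (CoordD.chr F g * CoordD.z F X) = 1 := by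
    simp [phiFunctional, CoordD.chr, CoordD.z, MonoidAlgebra.lift_of, -MonoidAlgebra.of_apply]
  rw [phi, LinearMap.comp_apply, LinearMap.comp_apply, e', map_add, TensorProduct.map_tmul,
    TensorProduct.map_tmul, h1, h2]
  simp

theorem phi_f_zero (x : LieD F X) {s : ℕ} (h : Fin s → X) (j : Fin s) :
    phi x h (f F j 0) = LieD.eval x (h j) • f F j 1 :=
  phi_eq_of_coact_eq x h (g := h j) (by
    rw [coact_f_zero, GradedTensorProduct.tmul, GradedTensorProduct.tmul, GradedTensorProduct.tmul,
      ← TensorProduct.smul_tmul', map_smul])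

theorem phi_f_one (x : LieD F X) {s : ℕ} (h : Fin s → X) (j : Fin s) :
    phi x h (f F j 1) = f F j 0 :=
  phi_eq_of_coact_eq x h (g := h j) (by rw [coact_f_one, add_comm])

theorem phi_f (x : LieD F X) {s : ℕ} (h : Fin s → X) (j : Fin s) (a : ZMod 2) :
    ∃ c : F, phi x h (f F j a) = c • f F j (a + 1) := by
  have h01 : a = 0 ∨ a = 1 := by revert a; decide
  rcases h01 with rfl | rfl
  · exact ⟨_, phi_f_zero x h j⟩
  · exact ⟨1, by rw [phi_f_one, one_smul]; rfl⟩

theorem phi_phi_f (x : LieD F X) {s : ℕ} (h : Fin s → X) (j : Fin s) (a : ZMod 2) :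
    phi x h (phi x h (f F j a)) = LieD.eval x (h j) • f F j a := by
  have h01 : a = 0 ∨ a = 1 := by revert a; decide
  rcases h01 with rfl | rfl
  · rw [phi_f_zero, map_smul, phi_f_one]
  · rw [phi_f_one, phi_f_zero]

theorem coact_f (x : LieD F X) {s : ℕ} (h : Fin s → X) (j : Fin s) (a : ZMod 2) :
    coact x h (f F j a) = f F j a ᵍ⊗ₜ[F] CoordD.chr F (h j) +
      phi x h (f F j a) ᵍ⊗ₜ[F] (CoordD.chr F (h j) * CoordD.z F X) := by
  have h01 : a = 0 ∨ a = 1 := by revert a; decide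
  rcases h01 with rfl | rfl
  · rw [phi_f_zero, coact_f_zero, GradedTensorProduct.tmul, GradedTensorProduct.tmul,
      GradedTensorProduct.tmul, ← TensorProduct.smul_tmul', map_smul]
  · rw [phi_f_one, coact_f_one, add_comm]

/-- The two claims are proved together: to multiply by one more generator, `tmul_mul_tmul_add` needs
the parity of `φ` of the shorter monomial. -/
theorem coact_monomial_and_phi_mem (x : LieD F X) {s : ℕ} (h : Fin s → X)
    (l : List (Fin s × ZMod 2)) :
    coact x h (monomial F l) = monomial F l ᵍ⊗ₜ[F] CoordD.chr F (weight h l) +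
      phi x h (monomial F l) ᵍ⊗ₜ[F] (CoordD.chr F (weight h l) * CoordD.z F X) ∧
    phi x h (monomial F l) ∈ parity F s ((l.map fun k => k.2).sum + 1) := by
  induction l with
  | nil =>
    -- The empty monomial is `1`, of weight `1`, and `τ(1) = 1 ⊗ 1` has no `z`-term; so `φ(1) = 0`.
    have e : coact x h (monomial F []) = monomial F [] ᵍ⊗ₜ[F] CoordD.chr F (weight h []) +
        (0 : FV F s) ᵍ⊗ₜ[F] (CoordD.chr F (weight h []) * CoordD.z F X) := by
      rw [CoordD.zero_tmul, add_zero]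
      change coact x h 1 = 1 ᵍ⊗ₜ[F] CoordD.chr F 1
      rw [map_one, CoordD.chr_one]
      rfl
    rw [phi_eq_of_coact_eq x h e]
    exact ⟨e, Submodule.zero_mem _⟩
  | cons k l ih =>
    obtain ⟨j, a⟩ := k
    have e := (map_mul (coact x h) (f F j a) (monomial F l)).trans
      ((congrArg₂ (· * ·) (coact_f x h j a) ih.1).trans
        (tmul_mul_tmul_add _ _ (h j) (weight h l) (monomial_mem_homog _ l) ih.2))
    have e' := phi_eq_of_coact_eq x h e
    rw [monomial_cons, e']
    refine ⟨e, Submodule.add_mem _ ?_ ?_⟩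
    · have := SetLike.GradedMul.mul_mem (f_mem F j a) ih.2
      rwa [← add_assoc] at this
    · obtain ⟨c, hc⟩ := phi_f x h j a
      rw [hc, Units.smul_def]
      refine zsmul_mem ?_ _
      rw [smul_mul_assoc]
      refine Submodule.smul_mem _ _ ?_
      have := SetLike.GradedMul.mul_mem (f_mem F j (a + 1)) (monomial_mem_homog _ l)
      rw [add_right_comm] at this
      exact this

/-- A monomial `a` of weight `g` satisfies `τ(a) = a ⊗ g + φ(a) ⊗ gz`. -/
theorem coact_monomial (x : LieD F X) {s : ℕ} (h : Fin s → X) (l : List (Fin s × ZMod 2)) :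
    coact x h (monomial F l) = monomial F l ᵍ⊗ₜ[F] CoordD.chr F (weight h l) +
      phi x h (monomial F l) ᵍ⊗ₜ[F] (CoordD.chr F (weight h l) * CoordD.z F X) :=
  (coact_monomial_and_phi_mem x h l).1

/-! ### `φ` as an odd superderivation compatible with the gradings -/

/-- An element of a span of monomials satisfies every linear condition that they satisfy. -/
theorem homog_induction {s : ℕ} {M : Type w} [AddCommMonoid M] {W : Fin s × ZMod 2 → M} {m : M}
    {N : Submodule F (FV F s)}
    (hN : ∀ l : List (Fin s × ZMod 2), (l.map W).sum = m → monomial F l ∈ N) {a : FV F s}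
    (ha : a ∈ SuperPoly.homog F (fun k : Fin s × ZMod 2 => k.2) W m) : a ∈ N := by
  refine Submodule.span_le.2 ?_ ha
  rintro _ ⟨l, hl, rfl⟩
  exact hN l hl

theorem phi_mem_parity (x : LieD F X) {s : ℕ} (h : Fin s → X) {i : ZMod 2} {a : FV F s}
    (ha : a ∈ parity F s i) : phi x h a ∈ parity F s (i + 1) :=
  homog_induction (N := (parity F s (i + 1)).comap (phi x h))
    (fun l hl => hl ▸ (coact_monomial_and_phi_mem x h l).2) ha

theorem phi_monomial_mul (x : LieD F X) {s : ℕ} (h : Fin s → X) (l l' : List (Fin s × ZMod 2)) :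
    phi x h (monomial F l * monomial F l') = monomial F l * phi x h (monomial F l') +
      (-1 : ℤˣ) ^ (l'.map fun k => k.2).sum • (phi x h (monomial F l) * monomial F l') :=
  phi_eq_of_coact_eq x h (g := weight h l * weight h l') (by
    rw [map_mul, coact_monomial, coact_monomial]
    exact tmul_mul_tmul_add _ _ _ _ (monomial_mem_homog _ l')
      (coact_monomial_and_phi_mem x h l').2)

/-- For a fixed parity `i` both sides are linear in `b` and in `a`, so monomials suffice. The sign
depends on `b` alone, which is why `a` may be arbitrary. -/
theorem phi_mul (x : LieD F X) {s : ℕ} (h : Fin s → X) {i : ZMod 2} (a : FV F s) {b : FV F s}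
    (hb : b ∈ parity F s i) :
    phi x h (a * b) = a * phi x h b + (-1 : ℤˣ) ^ i • (phi x h a * b) := by
  -- Writing the sign as a scalar of `F` turns both sides into `F`-linear maps, so that the identity
  -- cuts out a subspace.
  obtain ⟨ε, hε⟩ : ∃ ε : F, ∀ c : FV F s, (-1 : ℤˣ) ^ i • c = ε • c := by
    rcases Int.units_eq_one_or ((-1 : ℤˣ) ^ i) with e | e
    · exact ⟨1, fun c => by rw [e, one_smul, one_smul]⟩
    · exact ⟨-1, fun c => by rw [e, Units.neg_smul, one_smul, neg_smul, one_smul]⟩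
  rw [hε]
  refine homog_induction (N := LinearMap.eqLocus (phi x h ∘ₗ LinearMap.mulLeft F a)
    (LinearMap.mulLeft F a ∘ₗ phi x h + ε • LinearMap.mulLeft F (phi x h a))) (fun l hl => ?_) hb
  change phi x h (a * monomial F l) =
    a * phi x h (monomial F l) + ε • (phi x h a * monomial F l)
  have ha : a ∈ Submodule.span F (Set.range (monomial F (s := s))) := by
    rw [span_range_monomial]
    trivial
  refine Submodule.span_le (p := LinearMap.eqLocus
    (phi x h ∘ₗ LinearMap.mulRight F (monomial F l))
    (LinearMap.mulRight F (phi x h (monomial F l)) +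
      ε • (LinearMap.mulRight F (monomial F l) ∘ₗ phi x h))).2 ?_ ha
  rintro _ ⟨l', rfl⟩
  change phi x h (monomial F l' * monomial F l) = monomial F l' * phi x h (monomial F l) +
    ε • (phi x h (monomial F l') * monomial F l)
  rw [phi_monomial_mul, hl, hε]

/-- `φ` preserves each grading for which `f_{j,0}` and `f_{j,1}` have the same weight. -/
theorem phi_mem_homog (x : LieD F X) {s : ℕ} (h : Fin s → X) {M : Type w} [AddCommMonoid M]
    (W : Fin s → M) {m : M} {a : FV F s}
    (ha : a ∈ SuperPoly.homog F (fun k : Fin s × ZMod 2 => k.2) (fun k => W k.1) m) :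
    phi x h a ∈ SuperPoly.homog F (fun k : Fin s × ZMod 2 => k.2) (fun k => W k.1) m := by
  refine homog_induction (N := Submodule.comap (phi x h) (SuperPoly.homog F
    (fun k : Fin s × ZMod 2 => k.2) (fun k => W k.1) m)) ?_ ha
  rintro l rfl
  rw [Submodule.mem_comap]
  clear ha
  induction l with
  | nil =>
    -- The Leibniz rule for `1 * 1` reads `φ(1) = φ(1) + φ(1)`, whence `φ(1) = 0`.
    have := phi_monomial_mul (F := F) x h [] []
    have e : monomial F ([] : List (Fin s × ZMod 2)) = 1 := rfl
    rw [e] at this ⊢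
    simp at this
    rw [this]
    exact Submodule.zero_mem _
  | cons k l ih =>
    obtain ⟨j, a⟩ := k
    rw [monomial_cons, phi_mul x h _ (monomial_mem_homog _ l), Units.smul_def]
    obtain ⟨c, hc⟩ := phi_f x h j a
    have hg : ∀ (b : ZMod 2) {c : FV F s} {n : M}, c ∈ SuperPoly.homog F
        (fun k : Fin s × ZMod 2 => k.2) (fun k => W k.1) n → f F j b * c ∈ SuperPoly.homog F
        (fun k : Fin s × ZMod 2 => k.2) (fun k => W k.1) (W j + n) := by
      intro b c n hc
      have hj := SuperPoly.gen_mem_homog F (fun k : Fin s × ZMod 2 => k.2)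
        (fun k => W k.1) (j, b)
      exact SetLike.GradedMul.mul_mem hj hc
    rw [List.map_cons, List.sum_cons]
    refine Submodule.add_mem _ (hg a ih) ?_
    refine zsmul_mem ?_ _
    rw [hc, smul_mul_assoc]
    refine Submodule.smul_mem _ c ?_
    have hl := monomial_mem_homog (F := F) (fun k : Fin s × ZMod 2 => W k.1) l
    exact hg (a + 1) hl

theorem phi_mem_degree (x : LieD F X) {s : ℕ} (h : Fin s → X) {d : ℕ} {a : FV F s}
    (ha : a ∈ degree F s d) : phi x h a ∈ degree F s d :=
  phi_mem_homog x h (fun _ => 1) ha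

/-- Thus `φ²` acts as the element `x` of `Lie(D)`. It is an ordinary derivation, with eigenvalue
`x(h_j)` on the generators, and `x` turns products of characters into sums. -/
theorem phi_phi_monomial (x : LieD F X) {s : ℕ} (h : Fin s → X) (l : List (Fin s × ZMod 2)) :
    phi x h (phi x h (monomial F l)) = LieD.eval x (weight h l) • monomial F l := by
  induction l with
  | nil =>
    have e : phi x h (monomial F ([] : List (Fin s × ZMod 2))) = 0 := by
      have := phi_monomial_mul (F := F) x h [] []
      have e : monomial F ([] : List (Fin s × ZMod 2)) = 1 := rfl
      rw [e] at this ⊢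
      simpa using this
    rw [e, map_zero, show weight h ([] : List (Fin s × ZMod 2)) = 1 from rfl, LieD.eval_one,
      zero_smul]
  | cons k l ih =>
    obtain ⟨j, a⟩ := k
    have hl := monomial_mem_homog (F := F) (fun k : Fin s × ZMod 2 => k.2) l
    have hw : weight h ((j, a) :: l) = h j * weight h l := rfl
    rw [monomial_cons, phi_mul x h _ hl, map_add, phi_mul x h _ (phi_mem_parity x h hl), ih,
      Units.smul_def ((-1 : ℤˣ) ^ (l.map fun k => k.2).sum), map_zsmul, phi_mul x h _ hl, phi_phi_f,
      hw, LieD.eval_mul]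
    -- Applying `φ` raises the parity by one, so the two cross terms `φ(f) * φ(m)` have opposite
    -- signs and cancel; the sign in front of `φ²(f) * m` occurs twice.
    rcases Int.units_eq_one_or ((-1 : ℤˣ) ^ (l.map fun k => k.2).sum) with e | e <;>
      simp [uzpow_add, e, add_smul] <;> abel

/-! ### Invariants of `D` and of `D_{1,x}` -/

theorem coactD_monomial (x : LieD F X) {s : ℕ} (h : Fin s → X) (l : List (Fin s × ZMod 2)) :
    coactD x h (monomial F l) = monomial F l ⊗ₜ[F] MonoidAlgebra.of F X (weight h l) := by
  have e : coactLin x h (monomial F l) = monomial F l ⊗ₜ[F] CoordD.chr F (weight h l) +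
      phi x h (monomial F l) ⊗ₜ[F] (CoordD.chr F (weight h l) * CoordD.z F X) := by
    change (GradedTensorProduct.of F (parity F s) (CoordD.parity F X)).symm
      (coact x h (monomial F l)) = _
    rw [coact_monomial]
    rfl
  rw [coactD, LinearMap.comp_apply, e, map_add, TensorProduct.map_tmul, TensorProduct.map_tmul]
  simp [CoordD.chr, CoordD.z, -MonoidAlgebra.of_apply]

/-- The invariants of `D` are spanned by the monomials of trivial weight. -/
theorem invariantsD_eq_span (x : LieD F X) {s : ℕ} (h : Fin s → X) :
    invariantsD x h = Submodule.span F {a | ∃ l, weight h l = 1 ∧ a = monomial F l} := by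
  apply le_antisymm
  · intro a ha
    let ev : MonoidAlgebra F X →ₗ[F] F :=
      { toFun := fun b => b.coeff 1
        map_add' := fun b c => by simp
        map_smul' := fun c b => by simp }
    -- `P` is the projection to trivial weight: it takes the coefficient of the character `1` in
    -- `τ|_D`. It fixes invariants, fixes monomials of weight `1` and kills all other monomials.
    let P : FV F s →ₗ[F] FV F s := (TensorProduct.rid F (FV F s)).toLinearMap ∘ₗ
      TensorProduct.map LinearMap.id ev ∘ₗ coactD x h
    have hP : P a = a := by
      have e : coactD x h a = a ⊗ₜ[F] 1 := ha
      have e1 : ev 1 = 1 := by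
        change (MonoidAlgebra.of F X 1).coeff 1 = 1
        simp
      simp [P, e, e1]
    rw [← hP]
    have ha' : a ∈ Submodule.span F (Set.range (monomial F (s := s))) := by
      rw [span_range_monomial]
      trivial
    refine Submodule.span_le (p := (Submodule.span F _).comap P).2 ?_ ha'
    rintro _ ⟨l, rfl⟩
    rw [SetLike.mem_coe, Submodule.mem_comap]
    have e : P (monomial F l) = ev (MonoidAlgebra.of F X (weight h l)) • monomial F l := by
      simp [P, coactD_monomial, -MonoidAlgebra.of_apply]
    rw [e]
    by_cases hl : weight h l = 1
    · exact Submodule.smul_mem _ _ (Submodule.subset_span ⟨l, hl, rfl⟩)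
    · have : ev (MonoidAlgebra.of F X (weight h l)) = 0 := by
        change (MonoidAlgebra.of F X (weight h l)).coeff 1 = 0
        simp [hl]
      rw [this, zero_smul]
      exact Submodule.zero_mem _
  · refine Submodule.span_le.2 ?_
    rintro _ ⟨l, hl, rfl⟩
    change coactD x h (monomial F l) = monomial F l ⊗ₜ[F] 1
    rw [coactD_monomial, hl, map_one]

/-- Seen as the neutral component of the grading by `X`, written additively, the algebra `A` is
covered by `phi_mem_homog`. -/
theorem invariantsD_eq_homog (x : LieD F X) {s : ℕ} (h : Fin s → X) :
    invariantsD x h = SuperPoly.homog F (fun k : Fin s × ZMod 2 => k.2)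
      (fun k => Additive.ofMul (h k.1)) 0 := by
  rw [invariantsD_eq_span, SuperPoly.homog]
  congr 1

theorem phi_mem_invariantsD (x : LieD F X) {s : ℕ} (h : Fin s → X) {a : FV F s}
    (ha : a ∈ invariantsD x h) : phi x h a ∈ invariantsD x h := by
  rw [invariantsD_eq_homog] at ha ⊢
  exact phi_mem_homog x h (fun j => Additive.ofMul (h j)) ha

theorem phi_phi_eq_zero (x : LieD F X) {s : ℕ} (h : Fin s → X) {a : FV F s}
    (ha : a ∈ invariantsD x h) : phi x h (phi x h a) = 0 := by
  rw [invariantsD_eq_span] at ha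
  refine Submodule.span_le (p := LinearMap.ker (phi x h ∘ₗ phi x h)).2 ?_ ha
  rintro _ ⟨l, hl, rfl⟩
  change phi x h (phi x h (monomial F l)) = 0
  rw [phi_phi_monomial, hl, LieD.eval_one, zero_smul]

theorem mem_invariants_iff (x : LieD F X) {s : ℕ} (h : Fin s → X) (a : FV F s) :
    a ∈ invariants x h ↔ a ∈ invariantsD x h ∧ phi x h a = 0 := by
  constructor
  · intro ha
    have e : coactLin x h a = a ⊗ₜ[F] 1 := ha
    constructor
    · change coactD x h a = a ⊗ₜ[F] 1
      rw [coactD, LinearMap.comp_apply, e, TensorProduct.map_tmul]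
      simp
    · rw [phi, LinearMap.comp_apply, LinearMap.comp_apply, e, TensorProduct.map_tmul]
      simp [phiFunctional]
  · rintro ⟨ha, h0⟩
    -- This is the formula for monomials with `g = 1`, extended linearly to `A`.
    have key : coactLin x h a = a ⊗ₜ[F] 1 + phi x h a ⊗ₜ[F] CoordD.z F X := by
      rw [invariantsD_eq_span] at ha
      refine Submodule.span_le (p := LinearMap.eqLocus (coactLin x h)
        ((TensorProduct.mk F (FV F s) (CoordD F X)).flip 1 +
          (TensorProduct.mk F (FV F s) (CoordD F X)).flip (CoordD.z F X) ∘ₗ phi x h)).2 ?_ ha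
      rintro _ ⟨l, hl, rfl⟩
      change (GradedTensorProduct.of F (parity F s) (CoordD.parity F X)).symm
        (coact x h (monomial F l)) = _
      rw [coact_monomial, hl, CoordD.chr_one, one_mul]
      rfl
    change coactLin x h a = a ⊗ₜ[F] 1
    rw [key, h0, TensorProduct.zero_tmul, add_zero]

/-- Both `A` and `φA` are spanned by their homogeneous elements, because `A` is spanned by monomials
and `φ` preserves degrees. A basis of `φA` can therefore be chosen among homogeneous elements and
extended by homogeneous elements of `A`. -/
theorem exists_isAdaptedBasis (x : LieD F X) {s : ℕ} (h : Fin s → X) :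
    ∃ (I₁ I₂ : Type u) (b : I₁ ⊕ I₂ → FV F s), IsAdaptedBasis (invariantsD x h) (phi x h) b := by
  let S : Set (FV F s) := {a | a ∈ (invariantsD x h).map (phi x h) ∧ ∃ d, a ∈ degree F s d}
  let T : Set (FV F s) := {a | a ∈ invariantsD x h ∧ ∃ d, a ∈ degree F s d}
  have hmon : ∀ l : List (Fin s × ZMod 2), ∃ d, monomial F l ∈ degree F s d :=
    fun l => ⟨_, monomial_mem_homog _ l⟩
  have hT : Submodule.span F T = invariantsD x h := by
    apply le_antisymm (Submodule.span_le.2 fun a ha => ha.1)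
    intro a ha
    rw [invariantsD_eq_span] at ha
    refine Submodule.span_mono ?_ ha
    rintro _ ⟨l, hl, rfl⟩
    refine ⟨?_, hmon l⟩
    rw [invariantsD_eq_span]
    exact Submodule.subset_span ⟨l, hl, rfl⟩
  have hS : Submodule.span F S = (invariantsD x h).map (phi x h) := by
    apply le_antisymm (Submodule.span_le.2 fun a ha => ha.1)
    rw [← hT, Submodule.map_span]
    refine Submodule.span_mono ?_
    rintro _ ⟨a, ⟨ha, d, hd⟩, rfl⟩
    exact ⟨⟨a, ha, rfl⟩, d, phi_mem_degree x h hd⟩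
  have hST : S ⊆ T := by
    rintro a ⟨⟨c, hc, rfl⟩, hd⟩
    exact ⟨phi_mem_invariantsD x h hc, hd⟩
  obtain ⟨B, hBS, hBspan, hB⟩ := exists_linearIndependent F S
  -- `B` is indexed by `I₁`, and `C \ B` by `I₂`.
  obtain ⟨C, hCT, hBC, hTC, hC⟩ := exists_linearIndepOn_id_extension hB (hBS.trans hST)
  have hrange : Set.range (Sum.elim (fun i : B => (i : FV F s))
      (fun i : (C \ B : Set (FV F s)) => (i : FV F s))) = C := by
    rw [Set.Sum.elim_range, Subtype.range_coe, Subtype.range_coe, Set.union_sdiff_cancel hBC]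
  refine ⟨B, (C \ B : Set (FV F s)), Sum.elim (fun i => i) (fun i => i), ?_, ?_, ?_, ?_⟩
  · rintro (i | i)
    · exact (hBS i.2).2
    · exact (hCT i.2.1).2
  · have hinj : Function.Injective (Sum.elim (fun i : B => (i : FV F s))
        (fun i : (C \ B : Set (FV F s)) => (i : FV F s))) :=
      Function.Injective.sumElim Subtype.val_injective Subtype.val_injective
        fun i j e => j.2.2 (e ▸ i.2)
    rw [← linearIndepOn_id_range_iff hinj, hrange]
    exact hC
  · rw [hrange, ← hT]
    exact le_antisymm (Submodule.span_mono hCT) (Submodule.span_le.2 hTC)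
  · rw [Sum.elim_comp_inl, Subtype.range_coe, hBspan, hS]

/-! ### Linear algebra of a differential in an adapted basis -/

section AdaptedBasis

variable {s : ℕ} {A : Submodule F (FV F s)} {φ : FV F s →ₗ[F] FV F s} {I₁ I₂ : Type w}
  {b : I₁ ⊕ I₂ → FV F s}

theorem finsum_smul_eq_sum (r : I₁ →₀ F) (v : I₁ → FV F s) :
    ∑ᶠ j, r j • v j = r.sum fun j c => c • v j := by
  refine finsum_eq_sum_of_support_subset _ fun j hj => ?_
  rw [Finset.mem_coe, Finsupp.mem_support_iff]
  rintro h0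
  exact hj (by simp [h0])

/-- Row-finiteness makes each row a finitely supported function, so that linear independence applies
as injectivity of `Finsupp.linearCombination`. It also excludes the default value `0` that `finsum`
takes on infinite supports. -/
theorem isCoeffMatrix_iff {C : Matrix I₂ I₁ F} : IsCoeffMatrix φ b C ↔
    ∀ i, ∃ r : I₁ →₀ F, C i = r ∧
      φ (b (Sum.inr i)) = Finsupp.linearCombination F (b ∘ Sum.inl) r := by
  refine forall_congr' fun i => ⟨?_, ?_⟩
  · rintro ⟨hfin, e⟩
    refine ⟨Finsupp.ofSupportFinite (C i) hfin, rfl, ?_⟩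
    rw [e, Finsupp.linearCombination_apply]
    exact finsum_smul_eq_sum (Finsupp.ofSupportFinite (C i) hfin) (b ∘ Sum.inl)
  · rintro ⟨r, hr, e⟩
    rw [hr]
    refine ⟨?_, ?_⟩
    · exact r.hasFiniteSupport
    · rw [e, Finsupp.linearCombination_apply]
      exact (finsum_smul_eq_sum r (b ∘ Sum.inl)).symm

theorem IsAdaptedBasis.linearIndependent_inl (hb : IsAdaptedBasis A φ b) :
    LinearIndependent F (b ∘ Sum.inl) :=
  hb.linearIndependent.comp _ Sum.inl_injective

/-- Each `φ v_i` lies in `φA`, of which the `v_j` with `j ∈ I₁` form a basis; row `i` consists of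
its coordinates. -/
theorem IsAdaptedBasis.existsUnique_isCoeffMatrix (hb : IsAdaptedBasis A φ b) :
    ∃! C : Matrix I₂ I₁ F, IsCoeffMatrix φ b C := by
  have hmem : ∀ i, ∃ r : I₁ →₀ F,
      Finsupp.linearCombination F (b ∘ Sum.inl) r = φ (b (Sum.inr i)) := by
    intro i
    rw [← LinearMap.mem_range, Finsupp.range_linearCombination, hb.span_image]
    refine Submodule.mem_map_of_mem ?_
    rw [← hb.span_eq]
    exact Submodule.subset_span ⟨_, rfl⟩
  choose r hr using hmem
  refine ⟨fun i => r i, isCoeffMatrix_iff.2 fun i => ⟨r i, rfl, (hr i).symm⟩, fun C hC => ?_⟩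
  funext i
  obtain ⟨r', hr', e⟩ := isCoeffMatrix_iff.1 hC i
  rw [hr', hb.linearIndependent_inl (e.symm.trans (hr i).symm)]

/-- The coordinates of `φ(∑ d_i v_i)` in the basis of `φA` are the entries of `dC`. -/
theorem IsAdaptedBasis.map_sum_eq_zero_iff (hb : IsAdaptedBasis A φ b) {C : Matrix I₂ I₁ F}
    (hC : IsCoeffMatrix φ b C) (d : I₂ →₀ F) :
    φ (d.sum fun i c => c • b (Sum.inr i)) = 0 ↔ ∀ j, (d.sum fun i c => c * C i j) = 0 := by
  rw [isCoeffMatrix_iff] at hC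
  choose r hr e using hC
  have e' : φ (d.sum fun i c => c • b (Sum.inr i)) =
      Finsupp.linearCombination F (b ∘ Sum.inl) (d.sum fun i c => c • r i) := by
    rw [Finsupp.sum, Finsupp.sum, map_sum, map_sum]
    exact Finset.sum_congr rfl fun i _ => by rw [map_smul, map_smul, e]
  rw [e', map_eq_zero_iff _ hb.linearIndependent_inl, Finsupp.ext_iff]
  refine forall_congr' fun j => ?_
  simp [Finsupp.sum, Finsupp.finsetSum_apply, hr]

/-- Since `φ² = 0` on `A`, the `I₁`-part of an element of `A` always lies in the kernel. The
condition `φ(a) = 0` thus concerns only the `I₂`-part, where it says `dC = 0`. -/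
theorem IsAdaptedBasis.inf_ker_eq_span (hb : IsAdaptedBasis A φ b) (hA : A.map φ ≤ A)
    (hφ : ∀ a ∈ A, φ (φ a) = 0) {C : Matrix I₂ I₁ F} (hC : IsCoeffMatrix φ b C) :
    A ⊓ LinearMap.ker φ = Submodule.span F (Set.range (b ∘ Sum.inl) ∪
      {a | ∃ d : I₂ →₀ F, (∀ j : I₁, (d.sum fun i c => c * C i j) = 0) ∧
        a = d.sum fun i c => c • b (Sum.inr i)}) := by
  have hbA : ∀ i, b i ∈ A := fun i => hb.span_eq ▸ Submodule.subset_span ⟨i, rfl⟩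
  have hker : Submodule.span F (Set.range (b ∘ Sum.inl)) ≤ A ⊓ LinearMap.ker φ := by
    rw [hb.span_image]
    refine le_inf hA ?_
    rintro _ ⟨c, hc, rfl⟩
    exact hφ c hc
  apply le_antisymm
  · rintro a ⟨haA, ha⟩
    rw [← hb.span_eq, show b = Sum.elim (b ∘ Sum.inl) (b ∘ Sum.inr) from
      (Sum.elim_comp_inl_inr b).symm, Set.Sum.elim_range, Submodule.span_union,
      SetLike.mem_coe, Submodule.mem_sup] at haA
    obtain ⟨y, hy, z, hz, rfl⟩ := haA
    rw [← Finsupp.range_linearCombination] at hz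
    obtain ⟨d, rfl⟩ := hz
    refine Submodule.add_mem _ (Submodule.span_mono Set.subset_union_left hy)
      (Submodule.subset_span (Or.inr ⟨d, (hb.map_sum_eq_zero_iff hC d).1 ?_, rfl⟩))
    have hy0 : φ y = 0 := (hker hy).2
    have ha0 : φ (y + Finsupp.linearCombination F (b ∘ Sum.inr) d) = 0 := ha
    rwa [map_add, hy0, zero_add] at ha0
  · refine Submodule.span_le.2 (Set.union_subset (Submodule.span_le.1 hker) ?_)
    rintro _ ⟨d, hd, rfl⟩
    exact ⟨Submodule.sum_mem _ fun i _ => Submodule.smul_mem _ _ (hbA _),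
      (hb.map_sum_eq_zero_iff hC d).2 hd⟩

end AdaptedBasis

/-! ### Minimal degrees and the main theorem -/

theorem invariants_eq_inf_ker (x : LieD F X) {s : ℕ} (h : Fin s → X) :
    invariants x h = invariantsD x h ⊓ LinearMap.ker (phi x h) := by
  ext a
  exact mem_invariants_iff x h a

theorem minDegree_invariantsD (x : LieD F X) {s : ℕ} (h : Fin s → X) :
    minDegree (invariantsD x h) = minDegree (invariants x h) := by
  unfold minDegree
  suffices ∀ d, invariantsD x h ⊓ degree F s d ≠ ⊥ ↔ invariants x h ⊓ degree F s d ≠ ⊥ by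
    simp only [this]
  intro d
  rw [Submodule.ne_bot_iff, Submodule.ne_bot_iff]
  constructor
  · rintro ⟨a, ⟨ha, hd⟩, h0⟩
    -- Either `a` itself or `φ(a)` is a nonzero invariant of degree `d`; the latter is invariant
    -- because `φ²` vanishes on `A`.
    by_cases hφ : phi x h a = 0
    · exact ⟨a, ⟨(mem_invariants_iff x h a).2 ⟨ha, hφ⟩, hd⟩, h0⟩
    · exact ⟨phi x h a, ⟨(mem_invariants_iff x h _).2
        ⟨phi_mem_invariantsD x h ha, phi_phi_eq_zero x h ha⟩, phi_mem_degree x h hd⟩, hφ⟩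
  · rintro ⟨a, ⟨ha, hd⟩, h0⟩
    exact ⟨a, ⟨((mem_invariants_iff x h a).1 ha).1, hd⟩, h0⟩

end FV

theorem mainTheorem2 {F : Type u} [Field F] (hF : (2 : F) ≠ 0)
    {X : Type v} [CommGroup X] [Group.FG X]
    (hD : ConnectedSpace (PrimeSpectrum (MonoidAlgebra F X)))
    (x : LieD F X) {s : ℕ} (h : Fin s → X) :
    -- `φ` is an odd superderivation of `F[V]`
    ((∀ j : Fin s, FV.phi x h (FV.f F j 0) = LieD.eval x (h j) • FV.f F j 1 ∧
        FV.phi x h (FV.f F j 1) = FV.f F j 0) ∧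
      (∀ i : ZMod 2, ∀ a ∈ FV.parity F s i, FV.phi x h a ∈ FV.parity F s (i + 1)) ∧
      (∀ i : ZMod 2, ∀ a : FV F s, ∀ b ∈ FV.parity F s i,
        FV.phi x h (a * b) = a * FV.phi x h b + (-1 : ℤˣ) ^ i • (FV.phi x h a * b))) ∧
    -- it preserves degrees and maps `A = F[V]^D` to itself
    (∀ d : ℕ, ∀ a ∈ FV.degree F s d, FV.phi x h a ∈ FV.degree F s d) ∧
    (∀ a ∈ FV.invariantsD x h, FV.phi x h a ∈ FV.invariantsD x h) ∧
    -- the invariants of `D_{1,x}` are the kernel of `φ` on `A`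
    (∀ a : FV F s, a ∈ FV.invariants x h ↔ a ∈ FV.invariantsD x h ∧ FV.phi x h a = 0) ∧
    -- adapted homogeneous bases of `A` exist, and the invariants are described by each of them
    (∃ (I₁ I₂ : Type u) (b : I₁ ⊕ I₂ → FV F s),
      FV.IsAdaptedBasis (FV.invariantsD x h) (FV.phi x h) b) ∧
    (∀ (I₁ I₂ : Type w) (b : I₁ ⊕ I₂ → FV F s),
      FV.IsAdaptedBasis (FV.invariantsD x h) (FV.phi x h) b →
      (∃! C : Matrix I₂ I₁ F, FV.IsCoeffMatrix (FV.phi x h) b C) ∧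
      ∀ C : Matrix I₂ I₁ F, FV.IsCoeffMatrix (FV.phi x h) b C →
        FV.invariants x h = Submodule.span F (Set.range (b ∘ Sum.inl) ∪
          {a | ∃ d : I₂ →₀ F, (∀ j : I₁, (d.sum fun i c => c * C i j) = 0) ∧
            a = d.sum fun i c => c • b (Sum.inr i)})) ∧
    -- the minimal degrees agree
    FV.minDegree (FV.invariantsD x h) = FV.minDegree (FV.invariants x h) := by
  refine ⟨⟨fun j => ⟨FV.phi_f_zero x h j, FV.phi_f_one x h j⟩,
      fun i a ha => FV.phi_mem_parity x h ha, fun i a b hb => FV.phi_mul x h a hb⟩,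
    fun d a ha => FV.phi_mem_degree x h ha, fun a ha => FV.phi_mem_invariantsD x h ha,
    FV.mem_invariants_iff x h, FV.exists_isAdaptedBasis x h, fun I₁ I₂ b hb =>
      ⟨hb.existsUnique_isCoeffMatrix, fun C hC => ?_⟩, FV.minDegree_invariantsD x h⟩
  rw [FV.invariants_eq_inf_ker]
  refine hb.inf_ker_eq_span ?_ (fun a ha => FV.phi_phi_eq_zero x h ha) hC
  rintro _ ⟨a, ha, rfl⟩
  exact FV.phi_mem_invariantsD x h ha
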